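/- Let $d \ge 2$, let $x_1,\dots,x_d$ be $d$ elements that generate the free group $\mathbb{F}_d$ of rank $d$, and let $\zeta_1,\xi_1,\dots,\zeta_d,\xi_d$ be complex numbers of modulus $1$. For $g\in\mathbb{F}_d$ let $R_g$ be the right-multiplication operator on $\ell^2(\mathbb{F}_d)$, $(R_g f)(h)=f(hg^{-1})$, and let $$A=\sum_{i=1}^d\left(\zeta_i R_{x_i}+\xi_i R_{x_i^{-1}}\right).$$ Write $\mathrm{tr}(T)=(T\delta_1)(1)$ for the von Neumann trace of a bounded operator $T$ on $\ell^2(\mathbb{F}_d)$, where $\delta_1$ is the indicator function of the neutral element. (1) For all sufficiently small $t\in\mathbb{C}$ the following series converges and $$\sum_{k=0}^{\infty}\mathrm{tr}\left((A^*A)^k\right)t^k=\frac{4d-2}{2d-2+2d\sqrt{1-4(2d-1)t}},$$ with the principal branch of the square root. (2) The Fuglede--Kadison determinant $$\det{}_{\mathbb{F}_d}(A)=\lim_{\varepsilon\to0^+}\exp\left(\tfrac12\,\mathrm{tr}\left(\ln\left((A_\perp)^*A_\perp+\varepsilon\,\mathrm{Id}\right)\right)\right),$$ where $A_\perp$ is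 the restriction of $A$ to the orthogonal complement of its kernel and the trace of an operator on this complement is the trace of its extension by zero to $\ell^2(\mathbb{F}_d)$, exists as a limit and equals $$\det{}_{\mathbb{F}_d}(A)=\frac{(2d-1)^{\frac{2d-1}{2}}}{(2d)^{d-1}}.$$ -/

import Mathlib

open Filter Topology

noncomputable section

/-- The Hilbert space `ℓ²(G)` of square-summable complex functions on `G`. -/
abbrev EllTwo (G : Type*) : Type _ := lp (fun _ : G => ℂ) 2

/-- Right translation of a square-summable function: `h ↦ f (h g⁻¹)`. -/
def translateFun {G : Type*} [Group G] (g : G) (f : EllTwo G) : EllTwo G :=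
  ⟨fun h => f (h * g⁻¹), by
    have h2 : 0 < (2 : ENNReal).toReal := by norm_num
    exact (memℓp_gen_iff h2).2
      (((Equiv.mulRight g⁻¹).summable_iff).2 ((memℓp_gen_iff h2).1 (lp.memℓp f)))⟩

theorem norm_translateFun {G : Type*} [Group G] (g : G) (f : EllTwo G) :
    ‖translateFun g f‖ = ‖f‖ := by
  have h2 : 0 < (2 : ENNReal).toReal := by norm_num
  rw [lp.norm_eq_tsum_rpow h2, lp.norm_eq_tsum_rpow h2]
  congr 1
  exact (Equiv.mulRight g⁻¹).tsum_eq (fun h => ‖f h‖ ^ (2 : ENNReal).toReal)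

/-- The right-multiplication operator `R_g` on `ℓ²(G)`. It is right multiplication by `g` on the
canonical basis, `R_g δ_h = δ_{hg}`, i.e. `(R_g f)(h) = f (h g⁻¹)`. -/
def rightMulOp {G : Type*} [Group G] (g : G) : EllTwo G →L[ℂ] EllTwo G :=
  LinearIsometry.toContinuousLinearMap
    { toFun := translateFun g
      map_add' := fun _ _ => rfl
      map_smul' := fun _ _ => rfl
      norm_map' := norm_translateFun g }

open Classical in
/-- The basis vector `δ_1` of `ℓ²(G)` at the neutral element. -/
def deltaOne (G : Type*) [Group G] : EllTwo G := lp.single 2 (1 : G) (1 : ℂ)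

/-- The von Neumann trace `tr_G(T) = ⟨T δ_1, δ_1⟩`, the coefficient of `T δ_1` at the neutral
element. On `a_0 Id + a_1 R_{g_1} + ⋯ + a_r R_{g_r}` (with the `g_i ≠ 1`) its value is `a_0`. -/
def vnTrace {G : Type*} [Group G] (T : EllTwo G →L[ℂ] EllTwo G) : ℂ := (T (deltaOne G)) 1

/-- The orthogonal complement of the kernel of `A`. -/
abbrev kerPerp {G : Type*} (A : EllTwo G →L[ℂ] EllTwo G) : Submodule ℂ (EllTwo G) :=
  (LinearMap.ker A.toLinearMap)ᗮ

/-- `A_⊥`, the restriction of `A` to the orthogonal complement of its kernel. -/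
def restrictPerp {G : Type*} (A : EllTwo G →L[ℂ] EllTwo G) : kerPerp A →L[ℂ] EllTwo G :=
  A ∘L (kerPerp A).subtypeL

/-- The von Neumann trace of an operator on a closed subspace `K` of `ℓ²(G)`: the trace of its
extension by zero on the orthogonal complement of `K`. -/
def vnTraceOn {G : Type*} [Group G] (K : Submodule ℂ (EllTwo G)) [K.HasOrthogonalProjection]
    (T : K →L[ℂ] K) : ℂ :=
  vnTrace (K.subtypeL ∘L T ∘L K.orthogonalProjectionOnto)

/-- The logarithm of a bounded operator on a Hilbert space, by functional calculus. It is used for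
positive invertible operators only, on whose spectrum the logarithm is continuous (and holomorphic
in a neighbourhood). -/
def opLog {H : Type*} [NormedAddCommGroup H] [InnerProductSpace ℂ H] [CompleteSpace H]
    (T : H →L[ℂ] H) : H →L[ℂ] H :=
  CFC.log T

/-- `exp (½ tr_G (ln ((A_⊥)^* A_⊥ + ε Id)))`. For `ε > 0` the operator inside `ln` is positive and
invertible, and its logarithm is self-adjoint, so that the von Neumann trace of the logarithm is
real. -/
def fkDetReg {G : Type*} [Group G] (A : EllTwo G →L[ℂ] EllTwo G) (ε : ℝ) : ℝ :=
  Real.exp ((1 / 2) * (vnTraceOn (kerPerp A)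
    (opLog (ContinuousLinearMap.adjoint (restrictPerp A) ∘L restrictPerp A
      + (ε : ℂ) • ContinuousLinearMap.id ℂ (kerPerp A)))).re)

/-- The Fuglede-Kadison determinant `det_G(A)`, the limit of `fkDetReg A ε` as `ε → 0⁺`. -/
def fkDet {G : Type*} [Group G] (A : EllTwo G →L[ℂ] EllTwo G) : ℝ :=
  limUnder (𝓝[>] (0 : ℝ)) (fkDetReg A)

/-- The operator `∑ i, (ζ_i R_{x_i} + ξ_i R_{x_i⁻¹})` on `ℓ²(G)`. -/
def symmetricOp {G : Type*} [Group G] {d : ℕ} (x : Fin d → G) (ζ ξ : Fin d → ℂ) :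
    EllTwo G →L[ℂ] EllTwo G :=
  ∑ i, (ζ i • rightMulOp (x i) + ξ i • rightMulOp (x i)⁻¹)

end

/-! Free groups of finite rank are Hopfian, so an automorphism carries the standard basis to the `x
i`, and `A` becomes a weighted sum over the edges of the `2d`-regular Cayley tree. On a tree the
weights can be gauged away: `phase` attaches unimodular numbers `(z, w)` to each vertex so that `A`
maps `w` times a radial function `F` to `z` times the adjacency sum of `F`, and `A^*` maps back from
`z` to `w`.

Put `q = 2d - 1`. The function `w C ρ^(n/2)` on even radii is in `ℓ²` if `q|ρ| < 1`, and for
suitable `C` it solves `(1 - t A^*A) u = δ₁` with `t = ρ/(1 + qρ)²` and `u(1) = (1 + qρ)/(1 - ρ)`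
(`exists_resolvent_letterOp`). For small `t` the Neumann series identifies `u(1)` with the
generating function; solving for `ρ` gives (1).

For (2), take `ρ = -y/q` with `0 < y < 1`, so that `t = -1/ε` with `ε = q(1 - y)²/y`. The diagonal
resolvent entry `y/((1 - y)(q + y))` is the derivative in `ε` of the trace of `log (A^*A + ε)`,
which is asymptotic to `log ε` at infinity. Integration in `y` gives `q log q - log y - (q - 1) log
(q + y)`, and `ε → 0` means `y → 1`. Also `ε (A^*A + ε)⁻¹` has diagonal entry tending to `0`, so
`δ₁` is orthogonal to the kernel and passing to `A_⊥` changes nothing. -/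

namespace FreeGroup

universe u

variable {α : Type*}

/-! ### Word length and sphere growth in free groups -/

theorem mk_singleton_mul_mk (s : α × Bool) (L : List (α × Bool)) :
    mk [s] * mk L = mk (s :: L) := by
  rw [mul_mk]; rfl

theorem inv_mk_singleton (s : α × Bool) : (mk [s])⁻¹ = mk [(s.1, !s.2)] := by
  rw [inv_mk]; rfl

theorem mk_singleton_eq (s : α × Bool) : mk [s] = if s.2 then of s.1 else (of s.1)⁻¹ := by
  rcases s with ⟨i, _ | _⟩
  · exact (inv_mk_singleton (i, true)).symm
  · simp [of]

variable [DecidableEq α]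

theorem finite_norm_le [Finite α] (n : ℕ) : {g : FreeGroup α | g.norm ≤ n}.Finite :=
  ((List.finite_length_le (α × Bool) n).preimage toWord_injective.injOn).subset
    fun _ hg => hg

theorem norm_mk_singleton_mul (s : α × Bool) (g : FreeGroup α) :
    (mk [s] * g).norm =
      if g.toWord.head? = some (s.1, !s.2) then g.norm - 1 else g.norm + 1 := by
  conv_lhs => rw [← mk_toWord (x := g), mk_singleton_mul_mk]
  rw [norm, toWord_mk, reduce.cons, reduce_toWord, norm]
  rcases h : g.toWord with _ | ⟨a, l⟩
  · simp
  · have : (s.1 = a.1 ∧ s.2 = !a.2) ↔ a = (s.1, !s.2) := by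
      rcases s with ⟨i, b⟩; rcases a with ⟨j, c⟩
      cases b <;> cases c <;> simp [eq_comm]
    simp only [this, List.head?_cons, Option.some.injEq]
    split_ifs <;> simp

theorem norm_mul_mk_singleton (g : FreeGroup α) (s : α × Bool) :
    (g * mk [s]).norm = if g⁻¹.toWord.head? = some s then g.norm - 1 else g.norm + 1 := by
  rw [← norm_inv_eq, mul_inv_rev, inv_mk_singleton, norm_mk_singleton_mul, norm_inv_eq]
  simp

theorem norm_one_mul_mk_singleton (s : α × Bool) : ((1 : FreeGroup α) * mk [s]).norm = 1 := by
  rw [norm_mul_mk_singleton]; simp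

/-- Exactly one letter, the inverse of the last letter of `g`, cancels; all others lengthen the
word. -/
theorem sum_norm_mul_mk_singleton [Fintype α] {M : Type*} [AddCommMonoid M] {g : FreeGroup α}
    (hg : g ≠ 1) (F : ℕ → M) :
    ∑ s, F (g * mk [s]).norm
      = F (g.norm - 1) + (2 * Fintype.card α - 1) • F (g.norm + 1) := by
  obtain ⟨a, ha⟩ : ∃ a, g⁻¹.toWord.head? = some a := by
    rcases h : g⁻¹.toWord with _ | ⟨a, l⟩
    · exact absurd (inv_eq_one.1 (toWord_eq_nil_iff.1 h)) hg
    · exact ⟨a, rfl⟩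
  rw [← Finset.add_sum_erase _ _ (Finset.mem_univ a)]
  congr 1
  · rw [norm_mul_mk_singleton, if_pos ha]
  · rw [Finset.sum_congr rfl (g := fun _ => F (g.norm + 1))]
    · rw [Finset.sum_const, Finset.card_erase_of_mem (Finset.mem_univ a), Finset.card_univ,
        Fintype.card_prod, Fintype.card_bool, mul_comm]
    · intro s hs
      rw [norm_mul_mk_singleton, if_neg]
      rw [ha, Option.some.injEq]
      exact (Finset.ne_of_mem_erase hs).symm

/-- The sphere of radius `n` in a free group of finite rank. -/
noncomputable def sphere (α : Type*) [DecidableEq α] [Finite α] (n : ℕ) :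
    Finset (FreeGroup α) :=
  ((finite_norm_le n).subset (fun _ h => le_of_eq h : {g : FreeGroup α | g.norm = n} ⊆ _)).toFinset

theorem mem_sphere [Finite α] {n : ℕ} {g : FreeGroup α} : g ∈ sphere α n ↔ g.norm = n := by
  simp [sphere]

theorem card_sphere_succ_succ [Fintype α] (n : ℕ) :
    (sphere α (n + 2)).card = (2 * Fintype.card α - 1) * (sphere α (n + 1)).card := by
  -- Count the tree edges between the two spheres from either end; reversing an edge is the
  -- bijection.
  have key : ∑ g ∈ sphere α (n + 2), ∑ s : α × Bool, (if (g * mk [s]).norm = n + 1 then 1 else 0)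
      = ∑ g ∈ sphere α (n + 1), ∑ s : α × Bool,
        (if (g * mk [s]).norm = n + 2 then 1 else 0) := by
    rw [← Finset.sum_product', ← Finset.sum_product', ← Finset.card_filter, ← Finset.card_filter]
    have hinv : ∀ s : α × Bool, mk [s] * mk [(s.1, !s.2)] = 1 := fun s => by
      rw [← inv_mk_singleton, mul_inv_cancel]
    refine Finset.card_nbij' (fun p => (p.1 * mk [p.2], (p.2.1, !p.2.2)))
      (fun p => (p.1 * mk [p.2], (p.2.1, !p.2.2))) ?_ ?_ ?_ ?_
    all_goals
      rintro ⟨g, s⟩ h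
      simp only [Finset.coe_filter, Finset.mem_product, mem_sphere, Finset.mem_univ, and_true,
        Set.mem_ofPred_eq] at h
      simp [mem_sphere, mul_assoc, hinv, h.1, h.2]
  have h1 : ∀ g ∈ sphere α (n + 2),
      ∑ s : α × Bool, (if (g * mk [s]).norm = n + 1 then 1 else 0) = 1 := by
    intro g hg
    have hg' := mem_sphere.1 hg
    have hne : g ≠ 1 := by rintro rfl; simp at hg'
    rw [sum_norm_mul_mk_singleton hne (fun m => if m = n + 1 then 1 else 0), hg']
    simp
  have h2 : ∀ g ∈ sphere α (n + 1),
      ∑ s : α × Bool, (if (g * mk [s]).norm = n + 2 then 1 else 0) = 2 * Fintype.card α - 1 := by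
    intro g hg
    have hg' := mem_sphere.1 hg
    have hne : g ≠ 1 := by rintro rfl; simp at hg'
    rw [sum_norm_mul_mk_singleton hne (fun m => if m = n + 2 then 1 else 0), hg']
    simp
  rw [Finset.sum_congr rfl h1, Finset.sum_congr rfl h2] at key
  simpa [mul_comm] using key

theorem card_sphere_succ [Fintype α] (n : ℕ) :
    (sphere α (n + 1)).card = (2 * Fintype.card α - 1) ^ n * (sphere α 1).card := by
  induction n with
  | zero => simp
  | succ n ih => rw [card_sphere_succ_succ, ih, pow_succ']; ring

theorem summable_pow_norm [Fintype α] {p : ℝ} (hp : 0 ≤ p)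
    (hp' : ((2 * Fintype.card α - 1 : ℕ) : ℝ) * p < 1) :
    Summable fun g : FreeGroup α => p ^ g.norm := by
  set Q : ℝ := ((2 * Fintype.card α - 1 : ℕ) : ℝ)
  have hs : Summable fun n : ℕ => ((sphere α n).card : ℝ) * p ^ n := by
    rw [← summable_nat_add_iff 1]
    refine ((summable_geometric_of_lt_one (by positivity) hp').mul_left
      (((sphere α 1).card : ℝ) * p)).congr fun n => ?_
    rw [card_sphere_succ n, Nat.cast_mul, Nat.cast_pow, mul_pow, pow_succ]
    ring
  refine summable_of_sum_le (c := ∑' n : ℕ, ((sphere α n).card : ℝ) * p ^ n)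
    (fun g => by positivity) fun s => ?_
  have hsub : s ⊆ (s.image norm).biUnion (sphere α) := fun g hg =>
    Finset.mem_biUnion.2 ⟨g.norm, Finset.mem_image_of_mem _ hg, mem_sphere.2 rfl⟩
  calc ∑ g ∈ s, p ^ g.norm
      ≤ ∑ g ∈ (s.image norm).biUnion (sphere α), p ^ g.norm :=
        Finset.sum_le_sum_of_subset_of_nonneg hsub fun _ _ _ => by positivity
    _ = ∑ n ∈ s.image norm, ∑ g ∈ sphere α n, p ^ g.norm := by
        refine Finset.sum_biUnion fun m _ n _ hmn => Finset.disjoint_left.2 fun g hm hn => hmn ?_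
        rw [← mem_sphere.1 hm, ← mem_sphere.1 hn]
    _ = ∑ n ∈ s.image norm, ((sphere α n).card : ℝ) * p ^ n := by
        refine Finset.sum_congr rfl fun n _ => ?_
        rw [Finset.sum_congr rfl fun g hg => by rw [mem_sphere.1 hg], Finset.sum_const,
          nsmul_eq_mul]
    _ ≤ _ := hs.sum_le_tsum _ fun _ _ => by positivity

/-! ### Residual finiteness and the Hopf property -/

/-- A partial left translation of the ball of radius `n`, extended to a permutation. -/
theorem exists_perm_ball [Finite α] (n : ℕ) (a : FreeGroup α) :
    ∃ σ : Equiv.Perm {g : FreeGroup α // g.norm ≤ n},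
      ∀ g (h : (a * g.1).norm ≤ n), σ g = ⟨a * g.1, h⟩ := by
  classical
  have : Finite {g : FreeGroup α // g.norm ≤ n} := finite_norm_le n
  let e : {g : {g : FreeGroup α // g.norm ≤ n} // (a * g.1).norm ≤ n} ≃
      {g : {g : FreeGroup α // g.norm ≤ n} // (a⁻¹ * g.1).norm ≤ n} :=
    { toFun := fun g => ⟨⟨a * g.1.1, g.2⟩, by simpa using g.1.2⟩
      invFun := fun g => ⟨⟨a⁻¹ * g.1.1, g.2⟩, by simpa using g.1.2⟩
      left_inv := fun g => by simp
      right_inv := fun g => by simp }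
  exact ⟨e.extendSubtype, fun g h => e.extendSubtype_apply_of_mem g h⟩

theorem exists_finite_perm_ne_one {α : Type u} [DecidableEq α] [Finite α] {w : FreeGroup α}
    (hw : w ≠ 1) : ∃ (X : Type u) (_ : Finite X) (f : FreeGroup α →* Equiv.Perm X), f w ≠ 1 := by
  set n := w.norm
  choose σ hσ using fun i : α => exists_perm_ball n (of i)
  refine ⟨{g : FreeGroup α // g.norm ≤ n}, finite_norm_le n, lift σ, fun h => hw ?_⟩
  let b : {g : FreeGroup α // g.norm ≤ n} := ⟨1, norm_one.trans_le n.zero_le⟩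
  -- Every suffix of `w` stays in the ball of radius `n`, so the permutations act as true
  -- translations along the path from `1` to `w`.
  have key : ∀ L : List (α × Bool), L.length ≤ n → (lift σ (mk L) b).1 = mk L := by
    intro L
    induction L with
    | nil => intro _; rw [← one_eq_mk, MonoidHom.map_one]; rfl
    | cons s L ih =>
      intro hL
      have hL' : L.length ≤ n := (Nat.le_succ _).trans hL
      have hn : (mk [s] * mk L).norm ≤ n := by
        rw [mk_singleton_mul_mk]; exact norm_mk_le.trans hL
      have ih' : lift σ (mk L) b = ⟨mk L, norm_mk_le.trans hL'⟩ := Subtype.ext (ih hL')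
      rw [← mk_singleton_mul_mk, MonoidHom.map_mul, Equiv.Perm.mul_apply, ih']
      rcases s with ⟨i, _ | _⟩
      · rw [mk_singleton_eq] at hn ⊢
        simp only [Bool.false_eq_true, if_false] at hn ⊢
        rw [MonoidHom.map_inv, lift_apply_of]
        have := hσ i ⟨_, hn⟩ (by simpa using norm_mk_le.trans hL')
        simp only [mul_inv_cancel_left] at this
        rw [← this]; exact congrArg Subtype.val ((σ i).symm_apply_apply _)
      · rw [mk_singleton_eq] at hn ⊢
        simp only [if_true] at hn ⊢
        rw [lift_apply_of, hσ i ⟨mk L, norm_mk_le.trans hL'⟩ hn]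
  have := key w.toWord le_rfl
  rw [mk_toWord, h] at this
  exact this.symm

/-- Free groups of finite rank are Hopfian. -/
theorem injective_of_surjective [Finite α] (φ : FreeGroup α →* FreeGroup α)
    (hφ : Function.Surjective φ) : Function.Injective φ := by
  refine (injective_iff_map_eq_one φ).2 fun w hw => by_contra fun hne => ?_
  obtain ⟨X, hX, f, hf⟩ := exists_finite_perm_ne_one hne
  have : Finite (FreeGroup α →* Equiv.Perm X) :=
    Finite.of_equiv (α → Equiv.Perm X) lift
  have hinj : Function.Injective fun g : FreeGroup α →* Equiv.Perm X => g.comp φ :=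
    fun g g' h => (MonoidHom.cancel_right hφ).1 h
  obtain ⟨g, rfl⟩ := Finite.surjective_of_injective hinj f
  exact hf (by simp [hw])

/-- A generating family of a free group indexed by its rank is the image of the standard basis
under an automorphism. -/
theorem exists_mulEquiv_of_closure_eq_top [Finite α] {x : α → FreeGroup α}
    (hx : Subgroup.closure (Set.range x) = ⊤) :
    ∃ e : FreeGroup α ≃* FreeGroup α, ∀ i, e (of i) = x i := by
  have hsurj : Function.Surjective (lift x) := by
    rw [← MonoidHom.range_eq_top, range_lift_eq_closure, hx]
  exact ⟨MulEquiv.ofBijective (lift x) ⟨injective_of_surjective _ hsurj, hsurj⟩,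
    fun i => lift_apply_of⟩

end FreeGroup

/-! ### Translation operators and the trace vector -/

section RightMul

variable {G : Type*} [Group G]

theorem rightMulOp_apply (g : G) (f : EllTwo G) (h : G) : rightMulOp g f h = f (h * g⁻¹) := rfl

theorem adjoint_rightMulOp (g : G) :
    ContinuousLinearMap.adjoint (rightMulOp g) = rightMulOp g⁻¹ := by
  symm
  rw [ContinuousLinearMap.eq_adjoint_iff]
  intro f₁ f₂
  rw [lp.inner_eq_tsum, lp.inner_eq_tsum, ← (Equiv.mulRight g⁻¹).tsum_eq]
  refine tsum_congr fun h => ?_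
  simp [rightMulOp_apply]

theorem deltaOne_apply [DecidableEq G] (h : G) : deltaOne G h = if h = 1 then 1 else 0 := by
  classical
  simp [deltaOne, lp.single_apply, Pi.single_apply]

theorem inner_deltaOne (f : EllTwo G) : inner ℂ (deltaOne G) f = f 1 := by
  classical
  simp [deltaOne, lp.inner_single_left]

theorem norm_deltaOne : ‖deltaOne G‖ = 1 := by
  classical
  simp [deltaOne, lp.norm_single]

theorem vnTrace_eq_inner (T : EllTwo G →L[ℂ] EllTwo G) :
    vnTrace T = inner ℂ (deltaOne G) (T (deltaOne G)) :=
  (inner_deltaOne _).symm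

end RightMul

/-! ### Gauging away the weights -/

section Phase

/-- The monomial permutation `(z, w) ↦ (a w, b⁻¹ z)` of pairs of phases. -/
noncomputable def phaseStep (a b : Circle) : Equiv.Perm (Circle × Circle) where
  toFun z := (a * z.2, b⁻¹ * z.1)
  invFun z := (b * z.2, a⁻¹ * z.1)
  left_inv z := by simp
  right_inv z := by simp

theorem phaseStep_inv (a b : Circle) : (phaseStep a b)⁻¹ = phaseStep b a := rfl

variable {α G : Type*} [Group G]

/-- The two phases transported along a word, which conjugate the weights of a weighted sum of
letters to `1`. -/
noncomputable def phase (e : FreeGroup α ≃* G) (c : α × Bool → Circle) (h : G) : Circle × Circle :=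
  FreeGroup.lift (fun i => phaseStep (c (i, false)) (c (i, true))) (e.symm h)⁻¹ (1, 1)

theorem phase_one (e : FreeGroup α ≃* G) (c : α × Bool → Circle) : phase e c 1 = (1, 1) := by
  simp [phase]

/-- The inverse in `phase` turns appending a letter on the right into applying one more permutation
on the left. -/
theorem phase_mul (e : FreeGroup α ≃* G) (c : α × Bool → Circle) (h : G) (s : α × Bool) :
    phase e c (h * e (FreeGroup.mk [s])) =
      phaseStep (c s) (c (s.1, !s.2)) (phase e c h) := by
  have key : FreeGroup.lift (fun i => phaseStep (c (i, false)) (c (i, true)))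
      (FreeGroup.mk [s])⁻¹ = phaseStep (c s) (c (s.1, !s.2)) := by
    rcases s with ⟨i, _ | _⟩
    · rw [FreeGroup.mk_singleton_eq]; simp
    · rw [FreeGroup.mk_singleton_eq]; simp [phaseStep_inv]
  rw [phase, map_mul, MulEquiv.symm_apply_apply, mul_inv_rev, MonoidHom.map_mul,
    Equiv.Perm.mul_apply, key, phase]

end Phase

/-! ### Radial functions on the tree and the explicit resolvent -/

section Tree

variable {α G : Type*} [Fintype α] [Group G]

/-- The sum of all letters of a free group with weights of modulus one, acting by right
multiplication. -/
noncomputable def letterOp (e : FreeGroup α ≃* G) (c : α × Bool → Circle) : EllTwo G →L[ℂ] EllTwo G :=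
  ∑ s, (c s : ℂ) • rightMulOp (e (FreeGroup.mk [s]))

theorem sum_smul_rightMulOp_apply {ι : Type*} (t : Finset ι) (a : ι → ℂ) (g : ι → G)
    (f : EllTwo G) (h : G) :
    (∑ s ∈ t, a s • rightMulOp (g s)) f h = ∑ s ∈ t, a s * f (h * (g s)⁻¹) := by
  rw [sum_apply, lp.coeFn_sum]
  exact Finset.sum_apply _ _ _

theorem letterOp_apply (e : FreeGroup α ≃* G) (c : α × Bool → Circle) (f : EllTwo G) (h : G) :
    letterOp e c f h
      = ∑ s : α × Bool, (c (s.1, !s.2) : ℂ) * f (h * e (FreeGroup.mk [s])) := by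
  have h1 : letterOp e c f h = ∑ s, (c s : ℂ) * f (h * (e (FreeGroup.mk [s]))⁻¹) :=
    sum_smul_rightMulOp_apply _ _ _ _ _
  rw [h1]
  refine Fintype.sum_equiv ((Equiv.refl α).prodCongr Equiv.boolNot) _ _ fun s => ?_
  rw [← map_inv, FreeGroup.inv_mk_singleton]
  change _ = (c (s.1, !!s.2) : ℂ) * f (h * e (FreeGroup.mk [(s.1, !s.2)]))
  rw [Bool.not_not]

theorem adjoint_letterOp_apply (e : FreeGroup α ≃* G) (c : α × Bool → Circle) (f : EllTwo G)
    (h : G) : ContinuousLinearMap.adjoint (letterOp e c) f h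
      = ∑ s : α × Bool, ((c s)⁻¹ : Circle) * f (h * e (FreeGroup.mk [s])) := by
  simp only [letterOp, map_sum, map_smulₛₗ, adjoint_rightMulOp, Circle.coe_inv_eq_conj]
  rw [sum_smul_rightMulOp_apply]
  simp

variable [DecidableEq α]

/-- The adjacency operator of the regular tree on radial functions. -/
def radialSum (N : ℕ) (F : ℕ → ℂ) : ℕ → ℂ
  | 0 => N * F 1
  | n + 1 => F n + (N - 1) * F (n + 2)

theorem sum_norm_mul_letter (e : FreeGroup α ≃* G) [Nonempty α] (F : ℕ → ℂ) (h : G) :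
    ∑ s, F (e.symm (h * e (FreeGroup.mk [s]))).norm
      = radialSum (2 * Fintype.card α) F (e.symm h).norm := by
  simp only [map_mul, MulEquiv.symm_apply_apply]
  by_cases h1 : e.symm h = 1
  · rw [h1, FreeGroup.norm_one, Finset.sum_congr rfl fun s _ => by
      rw [FreeGroup.norm_one_mul_mk_singleton]]
    simp [radialSum, mul_comm]
  · rw [FreeGroup.sum_norm_mul_mk_singleton h1]
    obtain ⟨n, hn⟩ := Nat.exists_eq_succ_of_ne_zero (mt FreeGroup.norm_eq_zero.1 h1)
    have : 1 ≤ 2 * Fintype.card α := by have := Fintype.card_pos (α := α); omega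
    rw [hn]
    simp [radialSum, Nat.cast_sub this]

theorem letterOp_apply_of_radial [Nonempty α] (e : FreeGroup α ≃* G) (c : α × Bool → Circle)
    {F : ℕ → ℂ} {f : EllTwo G} (hf : ∀ h, f h = (phase e c h).2 * F (e.symm h).norm) (h : G) :
    letterOp e c f h
      = (phase e c h).1 * radialSum (2 * Fintype.card α) F (e.symm h).norm := by
  rw [letterOp_apply, ← sum_norm_mul_letter, Finset.mul_sum]
  refine Finset.sum_congr rfl fun s _ => ?_
  rw [hf, phase_mul]
  simp [phaseStep, ← mul_assoc]

theorem adjoint_letterOp_apply_of_radial [Nonempty α] (e : FreeGroup α ≃* G)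
    (c : α × Bool → Circle) {F : ℕ → ℂ} {f : EllTwo G}
    (hf : ∀ h, f h = (phase e c h).1 * F (e.symm h).norm) (h : G) :
    ContinuousLinearMap.adjoint (letterOp e c) f h
      = (phase e c h).2 * radialSum (2 * Fintype.card α) F (e.symm h).norm := by
  rw [adjoint_letterOp_apply, ← sum_norm_mul_letter, Finset.mul_sum]
  refine Finset.sum_congr rfl fun s _ => ?_
  rw [hf, phase_mul]
  simp [phaseStep, ← mul_assoc]

/-- The radial function `C ρ ^ (n / 2)` supported on even radii. -/
noncomputable def radialEven (C ρ : ℂ) (n : ℕ) : ℂ := if Even n then C * ρ ^ (n / 2) else 0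

theorem radialEven_two_mul (C ρ : ℂ) (k : ℕ) : radialEven C ρ (2 * k) = C * ρ ^ k := by
  simp [radialEven]

theorem radialEven_two_mul_add_one (C ρ : ℂ) (k : ℕ) : radialEven C ρ (2 * k + 1) = 0 := by
  simp [radialEven, parity_simps]

theorem radialSum_radialEven_two_mul (N : ℕ) (C ρ : ℂ) (k : ℕ) :
    radialSum N (radialEven C ρ) (2 * k) = 0 := by
  rcases k with _ | k
  · simp [radialSum, radialEven_two_mul_add_one C ρ 0]
  · change radialEven C ρ (2 * k + 1) + (N - 1) * radialEven C ρ (2 * (k + 1) + 1) = 0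
    simp [radialEven_two_mul_add_one]

theorem radialSum_radialEven_two_mul_add_one (N : ℕ) (C ρ : ℂ) (k : ℕ) :
    radialSum N (radialEven C ρ) (2 * k + 1) = C * (1 + (N - 1) * ρ) * ρ ^ k := by
  change radialEven C ρ (2 * k) + (N - 1) * radialEven C ρ (2 * (k + 1)) = _
  rw [radialEven_two_mul, radialEven_two_mul]
  ring

theorem radialSum_sq_radialEven_two_mul_add_one (N : ℕ) (C ρ : ℂ) (k : ℕ) :
    radialSum N (radialSum N (radialEven C ρ)) (2 * k + 1) = 0 := by
  change radialSum N (radialEven C ρ) (2 * k)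
    + (N - 1) * radialSum N (radialEven C ρ) (2 * (k + 1)) = 0
  simp [radialSum_radialEven_two_mul]

theorem radialSum_sq_radialEven_two_mul_add_two (N : ℕ) (C ρ : ℂ) (k : ℕ) :
    radialSum N (radialSum N (radialEven C ρ)) (2 * k + 1 + 1)
      = C * (1 + (N - 1) * ρ) ^ 2 * ρ ^ k := by
  change radialSum N (radialEven C ρ) (2 * k + 1)
    + (N - 1) * radialSum N (radialEven C ρ) (2 * (k + 1) + 1) = _
  rw [radialSum_radialEven_two_mul_add_one, radialSum_radialEven_two_mul_add_one]
  ring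

theorem radialSum_sq_radialEven_zero (N : ℕ) (C ρ : ℂ) :
    radialSum N (radialSum N (radialEven C ρ)) 0 = N * (C * (1 + (N - 1) * ρ)) := by
  change (N : ℂ) * radialSum N (radialEven C ρ) (2 * 0 + 1) = _
  rw [radialSum_radialEven_two_mul_add_one]
  ring

theorem norm_radialEven_sq_le (C ρ : ℂ) (n : ℕ) :
    ‖radialEven C ρ n‖ ^ 2 ≤ ‖C‖ ^ 2 * ‖ρ‖ ^ n := by
  unfold radialEven
  split_ifs with hev
  · obtain ⟨m, rfl⟩ := hev
    rw [show (m + m) / 2 = m by omega, norm_mul, norm_pow]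
    apply le_of_eq
    ring
  · rw [norm_zero, zero_pow two_ne_zero]
    positivity

theorem exists_ellTwo_radial_even [Nonempty α] (e : FreeGroup α ≃* G) (a : G → Circle) {ρ : ℂ}
    (hρ : (2 * Fintype.card α - 1 : ℝ) * ‖ρ‖ < 1) (C : ℂ) :
    ∃ u : EllTwo G, ∀ h, u h = a h * radialEven C ρ (e.symm h).norm := by
  have hcard : 1 ≤ 2 * Fintype.card α := by have := Fintype.card_pos (α := α); omega
  have hs : Summable fun g : G => ‖C‖ ^ 2 * ‖ρ‖ ^ (e.symm g).norm := by
    have h := FreeGroup.summable_pow_norm (α := α) (p := ‖ρ‖) (norm_nonneg _)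
      (by push_cast [Nat.cast_sub hcard]; exact hρ)
    exact (h.comp_injective e.symm.injective).mul_left _
  have hmem : Memℓp (E := fun _ : G => ℂ)
      (fun h => a h * radialEven C ρ (e.symm h).norm) 2 := by
    rw [memℓp_gen_iff (by norm_num)]
    simp only [ENNReal.toReal_ofNat, Real.rpow_ofNat, norm_mul, Circle.norm_coe, one_mul]
    exact hs.of_nonneg_of_le (fun g => by positivity) fun g => norm_radialEven_sq_le _ _ _
  exact ⟨⟨_, hmem⟩, fun h => rfl⟩

/-- The resolvent of `A^* A` at `δ₁`, for `A` a sum of all letters with weights of modulus one. -/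
theorem exists_resolvent_letterOp [Nonempty α] (e : FreeGroup α ≃* G) (c : α × Bool → Circle)
    {ρ : ℂ} (hρ : (2 * Fintype.card α - 1 : ℝ) * ‖ρ‖ < 1) :
    ∃ u : EllTwo G, u 1 = (1 + (2 * Fintype.card α - 1) * ρ) / (1 - ρ) ∧
      u - (ρ / (1 + (2 * Fintype.card α - 1) * ρ) ^ 2) •
        ContinuousLinearMap.adjoint (letterOp e c) (letterOp e c u) = deltaOne G := by
  classical
  set q : ℂ := 2 * Fintype.card α - 1 with hq
  have hcard : (1 : ℝ) ≤ Fintype.card α := by exact_mod_cast Fintype.card_pos (α := α)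
  have hqn : ‖q‖ = (2 * Fintype.card α - 1 : ℝ) := by
    have : q = ((2 * Fintype.card α - 1 : ℝ) : ℂ) := by push_cast; rfl
    rw [this, Complex.norm_real, Real.norm_of_nonneg (by linarith)]
  have h1 : 1 + q * ρ ≠ 0 := fun h => by
    have : ‖q * ρ‖ = 1 := by
      rw [show q * ρ = -1 by linear_combination h]; simp
    rw [norm_mul, hqn] at this
    linarith
  have h2 : 1 - ρ ≠ 0 := fun h => by
    have : ρ = 1 := by linear_combination -h
    rw [this, norm_one] at hρ
    linarith
  -- The equation at the identity reads `C (1 - ρ)/(1 + qρ) = 1`; at the other vertices `C` is free.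
  set C : ℂ := (1 + q * ρ) / (1 - ρ) with hC
  obtain ⟨u, hu⟩ := exists_ellTwo_radial_even e (fun h => (phase e c h).2) hρ C
  refine ⟨u, by rw [hu]; simp [phase_one, radialEven], ?_⟩
  have hAu := letterOp_apply_of_radial e c hu
  have hAAu := adjoint_letterOp_apply_of_radial e c hAu
  ext h
  have hcoe : ∀ (t : ℂ) (f g : EllTwo G), (f - t • g) h = f h - t * g h := fun t f g => rfl
  rw [hcoe, hAAu, hu, deltaOne_apply]
  have hN : ((2 * Fintype.card α : ℕ) : ℂ) = q + 1 := by rw [hq]; push_cast; ring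
  rcases hn : (e.symm h).norm with _ | n
  · have hh : h = 1 := by simpa using FreeGroup.norm_eq_zero.1 hn
    rw [hh, phase_one, radialSum_sq_radialEven_zero, hN, if_pos rfl, hC]
    simp only [radialEven, Circle.coe_one]
    simp
    field_simp
    ring
  · have hh : h ≠ 1 := by rintro rfl; simp at hn
    rw [if_neg hh]
    rcases Nat.even_or_odd' n with ⟨m, rfl | rfl⟩
    · rw [radialSum_sq_radialEven_two_mul_add_one, radialEven_two_mul_add_one]
      simp
    · rw [radialSum_sq_radialEven_two_mul_add_two, show 2 * m + 1 + 1 = 2 * (m + 1) by ring,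
        radialEven_two_mul, hN, add_sub_cancel_right]
      have : ρ / (1 + q * ρ) ^ 2 * (1 + q * ρ) ^ 2 = ρ := div_mul_cancel₀ _ (pow_ne_zero 2 h1)
      linear_combination (-((phase e c h).2 : ℂ) * C * ρ ^ m) * this

end Tree

/-! ### Bounds for the operator logarithm -/

section OperatorLog

variable {H : Type*} [NormedAddCommGroup H] [InnerProductSpace ℂ H]

theorem re_inner_apply_le_of_le {S T : H →L[ℂ] H} (h : S ≤ T) (v : H) :
    (inner ℂ v (S v)).re ≤ (inner ℂ v (T v)).re := by
  have := (ContinuousLinearMap.le_def S T |>.1 h).re_inner_nonneg_right v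
  rw [sub_apply, inner_sub_right] at this
  simpa using this

variable [CompleteSpace H]

theorem add_smul_id_eq_cfc {B : H →L[ℂ] H} (hB : 0 ≤ B) (ε : ℝ) :
    B + (ε : ℂ) • ContinuousLinearMap.id ℂ H = cfc (fun x : ℝ => x + ε) B := by
  have hsa : IsSelfAdjoint B := .of_nonneg hB
  rw [cfc_add_const ε (fun x => x) B, cfc_id' ℝ B]
  congr 1

theorem continuousOn_log_add {B : H →L[ℂ] H} (hB : 0 ≤ B) {ε : ℝ} (hε : 0 < ε) :
    ContinuousOn (fun x : ℝ => Real.log (x + ε)) (spectrum ℝ B) :=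
  ContinuousOn.log (by fun_prop) fun x hx => by
    have := spectrum_nonneg_of_nonneg hB hx
    positivity

theorem continuousOn_inv_add {B : H →L[ℂ] H} (hB : 0 ≤ B) {ε : ℝ} (hε : 0 < ε) :
    ContinuousOn (fun x : ℝ => (x + ε)⁻¹) (spectrum ℝ B) :=
  ContinuousOn.inv₀ (by fun_prop) fun x hx => by
    have := spectrum_nonneg_of_nonneg hB hx
    positivity

theorem opLog_add_smul_id {B : H →L[ℂ] H} (hB : 0 ≤ B) {ε : ℝ} (hε : 0 < ε) :
    opLog (B + (ε : ℂ) • ContinuousLinearMap.id ℂ H)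
      = cfc (fun x : ℝ => Real.log (x + ε)) B := by
  have hsa : IsSelfAdjoint B := .of_nonneg hB
  have hlog : ContinuousOn Real.log ((fun x : ℝ => x + ε) '' spectrum ℝ B) := by
    rintro _ ⟨x, hx, rfl⟩
    have := spectrum_nonneg_of_nonneg hB hx
    exact (Real.continuousAt_log (by positivity)).continuousWithinAt
  rw [opLog, CFC.log, add_smul_id_eq_cfc hB, ← cfc_comp' Real.log (fun x : ℝ => x + ε) B hlog]

theorem cfc_inv_add_apply {B : H →L[ℂ] H} (hB : 0 ≤ B) {ε : ℝ} (hε : 0 < ε) {u v : H}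
    (hu : B u + (ε : ℂ) • u = v) : cfc (fun x : ℝ => (x + ε)⁻¹) B v = u := by
  have hsa : IsSelfAdjoint B := .of_nonneg hB
  have h1 : cfc (fun x : ℝ => (x + ε)⁻¹) B * (B + (ε : ℂ) • ContinuousLinearMap.id ℂ H) = 1 := by
    rw [add_smul_id_eq_cfc hB, ← cfc_mul _ _ B (continuousOn_inv_add hB hε) (by fun_prop),
      ← cfc_one ℝ B]
    refine cfc_congr fun x hx => ?_
    have := spectrum_nonneg_of_nonneg hB hx
    exact inv_mul_cancel₀ (by positivity)
  have h2 := congrArg (fun T : H →L[ℂ] H => T u) h1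
  rw [← hu]
  exact h2

/-- The function `ε ↦ ⟨log (B + ε) v, v⟩` is concave with supergradient `⟨(B + ε)⁻¹ v, v⟩`. -/
theorem re_inner_opLog_sub_le {B : H →L[ℂ] H} (hB : 0 ≤ B) {a b : ℝ} (ha : 0 < a) (hb : 0 < b)
    {u v : H} (hu : B u + (a : ℂ) • u = v) :
    (inner ℂ v (opLog (B + (b : ℂ) • ContinuousLinearMap.id ℂ H) v)).re
      ≤ (inner ℂ v (opLog (B + (a : ℂ) • ContinuousLinearMap.id ℂ H) v)).re
        + (b - a) * (inner ℂ v u).re := by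
  have hsa : IsSelfAdjoint B := .of_nonneg hB
  -- The tangent-line bound for the concave function `log` at `x + a`, lifted by monotonicity of the
  -- functional calculus.
  have hle : cfc (fun x : ℝ => Real.log (x + b)) B
      ≤ cfc (fun x : ℝ => Real.log (x + a)) B + (b - a) • cfc (fun x : ℝ => (x + a)⁻¹) B := by
    rw [← cfc_const_mul _ _ B (continuousOn_inv_add hB ha),
      ← cfc_add B _ (fun x : ℝ => (b - a) * (x + a)⁻¹) (continuousOn_log_add hB ha)
        (continuousOn_const.mul (continuousOn_inv_add hB ha))]
    refine cfc_mono (fun x hx => ?_) (continuousOn_log_add hB hb)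
      ((continuousOn_log_add hB ha).add (continuousOn_const.mul (continuousOn_inv_add hB ha)))
    have hx0 := spectrum_nonneg_of_nonneg hB hx
    have h := Real.log_le_sub_one_of_pos (x := (x + b) / (x + a)) (by positivity)
    rw [Real.log_div (by positivity) (by positivity)] at h
    have : (x + b) / (x + a) - 1 = (b - a) * (x + a)⁻¹ := by field_simp; ring
    linarith
  have := re_inner_apply_le_of_le hle v
  rw [opLog_add_smul_id hB hb, opLog_add_smul_id hB ha]
  rw [add_apply, smul_apply, cfc_inv_add_apply hB ha hu, inner_add_right] at this
  simpa [inner_smul_right_eq_smul] using this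

theorem log_le_re_inner_opLog {B : H →L[ℂ] H} (hB : 0 ≤ B) {ε : ℝ} (hε : 0 < ε) {v : H}
    (hv : ‖v‖ = 1) :
    Real.log ε ≤ (inner ℂ v (opLog (B + (ε : ℂ) • ContinuousLinearMap.id ℂ H) v)).re := by
  have hsa : IsSelfAdjoint B := .of_nonneg hB
  have hle : algebraMap ℝ (H →L[ℂ] H) (Real.log ε) ≤ cfc (fun x : ℝ => Real.log (x + ε)) B := by
    rw [← cfc_const (Real.log ε) B]
    refine cfc_mono (fun x hx => ?_) (by fun_prop) (continuousOn_log_add hB hε)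
    have hx0 := spectrum_nonneg_of_nonneg hB hx
    exact Real.log_le_log hε (by linarith)
  have := re_inner_apply_le_of_le hle v
  rw [← opLog_add_smul_id hB hε, Algebra.algebraMap_eq_smul_one] at this
  simpa [inner_smul_right_eq_smul, inner_self_eq_norm_sq_to_K, hv] using this

/-- From `log (1 + x/ε) ≤ x/ε`. With the lower bound `log ε` this fixes the behaviour as `ε → ∞`,
hence the constant of integration. -/
theorem re_inner_opLog_le {B : H →L[ℂ] H} (hB : 0 ≤ B) {ε : ℝ} (hε : 0 < ε) {v : H}
    (hv : ‖v‖ = 1) :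
    (inner ℂ v (opLog (B + (ε : ℂ) • ContinuousLinearMap.id ℂ H) v)).re
      ≤ Real.log ε + ε⁻¹ * (inner ℂ v (B v)).re := by
  have hsa : IsSelfAdjoint B := .of_nonneg hB
  have hle : cfc (fun x : ℝ => Real.log (x + ε)) B
      ≤ algebraMap ℝ (H →L[ℂ] H) (Real.log ε) + ε⁻¹ • B := by
    conv_rhs => rw [← cfc_const (Real.log ε) B, ← cfc_const_mul_id ε⁻¹ B, ← cfc_add ..]
    refine cfc_mono (fun x hx => ?_) (continuousOn_log_add hB hε) (by fun_prop)
    have hx0 := spectrum_nonneg_of_nonneg hB hx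
    have h := Real.log_le_sub_one_of_pos (x := (x + ε) / ε) (by positivity)
    rw [Real.log_div (by positivity) (by positivity)] at h
    have : (x + ε) / ε - 1 = ε⁻¹ * x := by field_simp; ring
    linarith
  have := re_inner_apply_le_of_le hle v
  rw [← opLog_add_smul_id hB hε, Algebra.algebraMap_eq_smul_one] at this
  simpa [inner_smul_right_eq_smul, inner_add_right, inner_self_eq_norm_sq_to_K, hv] using this

end OperatorLog

/-! ### Integrating the resolvent -/

section Calculus

/-- The inequality at `a` and at `b` traps `f b - f a - (E b - E a) γ a` between `(E b - E a)(γ b -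
γ a)` and `0`. So the functional calculus need not be differentiated in `ε`. -/
theorem hasDerivAt_of_le_mul_sub {f E γ : ℝ → ℝ} {s : Set ℝ} (hs : IsOpen s)
    (h : ∀ a ∈ s, ∀ b ∈ s, f b ≤ f a + (E b - E a) * γ a) {a E' : ℝ} (ha : a ∈ s)
    (hE : HasDerivAt E E' a) (hγ : ContinuousAt γ a) : HasDerivAt f (E' * γ a) a := by
  rw [hasDerivAt_iff_isLittleO]
  have h1 : (fun b => (E b - E a) * (γ b - γ a)) =o[𝓝 a] fun b => b - a := by
    have hγ' : (fun b => γ b - γ a) =o[𝓝 a] fun _ => (1 : ℝ) := by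
      rw [Asymptotics.isLittleO_one_iff]
      simpa using hγ.tendsto.sub_const (γ a)
    simpa using hE.isBigO_sub.mul_isLittleO hγ'
  have h2 : (fun b => f b - f a - (E b - E a) * γ a) =o[𝓝 a] fun b => b - a := by
    refine (Asymptotics.IsBigO.of_bound 1 ?_).trans_isLittleO h1
    filter_upwards [hs.mem_nhds ha] with b hb
    have hu := h a ha b hb
    have hl := h b hb a ha
    rw [one_mul, Real.norm_eq_abs, Real.norm_eq_abs, abs_of_nonpos (by linarith)]
    refine le_trans ?_ (neg_le_abs _)
    linarith
  have h3 : (fun b => (E b - E a - (b - a) * E') * γ a) =o[𝓝 a] fun b => b - a := by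
    have := hasDerivAt_iff_isLittleO.1 hE
    simp only [smul_eq_mul] at this
    simpa [mul_comm] using this.const_mul_left (γ a)
  refine (h2.add h3).congr_left fun b => ?_
  simp only [smul_eq_mul]
  ring

theorem eq_of_supergradient {f : ℝ → ℝ} {q C : ℝ} (hq : 1 ≤ q)
    (hlow : ∀ ε > 0, Real.log ε ≤ f ε) (hupp : ∀ ε > 0, f ε ≤ Real.log ε + ε⁻¹ * C)
    (hsub : ∀ y ∈ Set.Ioo (0 : ℝ) 1, ∀ ε > 0,
      f ε ≤ f (q * (1 - y) ^ 2 / y) + (ε - q * (1 - y) ^ 2 / y) * (y / ((1 - y) * (q + y))))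
    {y : ℝ} (hy : y ∈ Set.Ioo (0 : ℝ) 1) :
    f (q * (1 - y) ^ 2 / y) = q * Real.log q - Real.log y - (q - 1) * Real.log (q + y) := by
  set E : ℝ → ℝ := fun y => q * (1 - y) ^ 2 / y with hEdef
  -- Chosen to be constant: `E' γ = -q(1 + y)/(y(q + y)) = -1/y - (q - 1)/(q + y)`.
  set Ψ : ℝ → ℝ := fun y => f (E y) + Real.log y + (q - 1) * Real.log (q + y) with hΨ
  have hEpos : ∀ y ∈ Set.Ioo (0 : ℝ) 1, 0 < E y := fun y hy => by
    have := hy.1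
    have : 0 < 1 - y := by linarith [hy.2]
    simp only [hEdef]
    positivity
  have hderiv : ∀ y ∈ Set.Ioo (0 : ℝ) 1, HasDerivAt Ψ 0 y := by
    intro y hy
    have h0 := hy.1
    have h1 : 0 < 1 - y := by linarith [hy.2]
    have h2 : 0 < q + y := by linarith
    have hE : HasDerivAt E ((q * (2 * (1 - y) * (-1)) * y - q * (1 - y) ^ 2 * 1) / y ^ 2) y := by
      have h3 : HasDerivAt (fun y : ℝ => q * (1 - y) ^ 2) (q * (2 * (1 - y) * (-1))) y := by
        have := (((hasDerivAt_id y).const_sub 1).pow 2).const_mul q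
        simpa using this
      exact h3.div (hasDerivAt_id y) h0.ne'
    have hγ : ContinuousAt (fun y : ℝ => y / ((1 - y) * (q + y))) y :=
      ContinuousAt.div (by fun_prop) (by fun_prop) (by positivity)
    have hf := hasDerivAt_of_le_mul_sub (f := fun y => f (E y)) isOpen_Ioo
      (fun a ha b hb => hsub a ha (E b) (hEpos b hb)) hy hE hγ
    have hl := ((hasDerivAt_id y).const_add q).log h2.ne' |>.const_mul (q - 1)
    have := (hf.add (Real.hasDerivAt_log h0.ne')).add hl
    refine this.congr_deriv ?_
    have e0 := h0.ne'
    have e1 := h1.ne'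
    have e2 := h2.ne'
    rw [id_eq]
    field_simp
    ring
  have hconst : ∀ a ∈ Set.Ioo (0 : ℝ) 1, Ψ a = Ψ y := fun a ha =>
    isOpen_Ioo.is_const_of_deriv_eq_zero isPreconnected_Ioo
      (fun a ha => (hderiv a ha).differentiableAt.differentiableWithinAt)
      (fun a ha => (hderiv a ha).deriv) ha hy
  have hmem : ∀ᶠ a in 𝓝[>] (0 : ℝ), a ∈ Set.Ioo (0 : ℝ) 1 := Ioo_mem_nhdsGT one_pos
  have hE0 : Tendsto (fun a => (E a)⁻¹ * C) (𝓝[>] 0) (𝓝 0) := by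
    have : Tendsto (fun a : ℝ => a / (q * (1 - a) ^ 2) * C) (𝓝 0) (𝓝 (0 / (q * (1 - 0) ^ 2) * C)) :=
      ContinuousAt.tendsto (f := fun a : ℝ => a / (q * (1 - a) ^ 2) * C)
        ((ContinuousAt.div (by fun_prop) (by fun_prop) (by simp; linarith)).mul_const C)
    simp only [zero_div, zero_mul] at this
    refine (this.mono_left nhdsWithin_le_nhds).congr fun a => ?_
    simp only [hEdef, inv_div]
  -- As `a → 0⁺`, `E a → ∞`, and both bounds on `f` agree with `log` in the limit.
  have hdiff : Tendsto (fun a => f (E a) - Real.log (E a)) (𝓝[>] 0) (𝓝 0) := by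
    refine tendsto_of_tendsto_of_tendsto_of_le_of_le' tendsto_const_nhds hE0 ?_ ?_
    · filter_upwards [hmem] with a ha
      linarith [hlow _ (hEpos a ha)]
    · filter_upwards [hmem] with a ha
      linarith [hupp _ (hEpos a ha)]
  have hlog : Tendsto (fun a : ℝ => Real.log q + 2 * Real.log (1 - a) + (q - 1) * Real.log (q + a))
      (𝓝[>] 0) (𝓝 (q * Real.log q)) := by
    have : ContinuousAt (fun a : ℝ => Real.log q + 2 * Real.log (1 - a)
        + (q - 1) * Real.log (q + a)) 0 := by
      have e1 : (1 : ℝ) - 0 ≠ 0 := by norm_num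
      have e2 : q + 0 ≠ 0 := by linarith
      fun_prop (disch := assumption)
    have h := this.tendsto.mono_left (nhdsWithin_le_nhds (s := Set.Ioi 0))
    convert h using 2
    simp
    ring
  have hlim : Tendsto Ψ (𝓝[>] 0) (𝓝 (q * Real.log q)) := by
    have := hdiff.add hlog
    rw [zero_add] at this
    refine this.congr' ?_
    filter_upwards [hmem] with a ha
    have h0 := ha.1
    have h1 : 0 < 1 - a := by linarith [ha.2]
    have : Real.log (E a) = Real.log q + 2 * Real.log (1 - a) - Real.log a := by
      simp only [hEdef]
      rw [Real.log_div (by positivity) h0.ne', Real.log_mul (by positivity) (by positivity),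
        Real.log_pow]
      push_cast
      ring
    simp only [hΨ]
    linarith
  have heq : Ψ y = q * Real.log q := by
    refine tendsto_nhds_unique (tendsto_const_nhds.congr' ?_) hlim
    filter_upwards [hmem] with a ha using (hconst a ha).symm
  simp only [hΨ] at heq
  linarith

/-- The root in `(0, 1)` of `q (1 - y)² = ε y`. -/
noncomputable def smallRoot (q ε : ℝ) : ℝ := (2 * q + ε - √(ε ^ 2 + 4 * q * ε)) / (2 * q)

theorem smallRoot_mem_Ioo {q ε : ℝ} (hq : 0 < q) (hε : 0 < ε) :
    smallRoot q ε ∈ Set.Ioo (0 : ℝ) 1 := by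
  have h1 : √(ε ^ 2 + 4 * q * ε) < 2 * q + ε := by
    rw [Real.sqrt_lt' (by positivity)]
    nlinarith
  have h2 : ε < √(ε ^ 2 + 4 * q * ε) := by
    rw [Real.lt_sqrt hε.le]
    nlinarith
  rw [smallRoot]
  exact ⟨div_pos (by linarith) (by linarith), (div_lt_one (by linarith)).2 (by linarith)⟩

theorem smallRoot_spec {q ε : ℝ} (hq : 0 < q) (hε : 0 < ε) :
    q * (1 - smallRoot q ε) ^ 2 / smallRoot q ε = ε := by
  rw [div_eq_iff (smallRoot_mem_Ioo hq hε).1.ne']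
  have := Real.sq_sqrt (show 0 ≤ ε ^ 2 + 4 * q * ε by positivity)
  rw [smallRoot]
  generalize √(ε ^ 2 + 4 * q * ε) = r at this
  field_simp
  linear_combination this

theorem smallRoot_eq {q y : ℝ} (hq : 0 < q) (hy : y ∈ Set.Ioo (0 : ℝ) 1) :
    smallRoot q (q * (1 - y) ^ 2 / y) = y := by
  have hy0 := hy.1
  have hy1 : 0 < 1 - y := by linarith [hy.2]
  have hε : 0 < q * (1 - y) ^ 2 / y := by positivity
  have hz := smallRoot_mem_Ioo hq hε
  have h := smallRoot_spec hq hε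
  set z := smallRoot q (q * (1 - y) ^ 2 / y)
  rw [div_eq_div_iff hz.1.ne' hy0.ne'] at h
  -- The two roots of the quadratic are mutually inverse, so only one lies in `(0, 1)`.
  have h1 : q * (1 - y * z) * (y - z) = 0 := by linear_combination h
  have h2 : 1 - y * z ≠ 0 := by nlinarith [hz.1, hz.2, hy.2]
  rcases mul_eq_zero.1 h1 with h3 | h3
  · exact absurd h3 (mul_ne_zero hq.ne' h2)
  · linarith

theorem tendsto_smallRoot {q : ℝ} (hq : 0 < q) : Tendsto (smallRoot q) (𝓝[>] 0) (𝓝 1) := by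
  have : Continuous (smallRoot q) := by
    unfold smallRoot
    fun_prop
  have h := this.tendsto 0
  have h1 : smallRoot q 0 = 1 := by
    simp [smallRoot, hq.ne']
  rw [h1] at h
  exact h.mono_left nhdsWithin_le_nhds

end Calculus

/-! ### From resolvents to determinant and moments -/

section FugledeKadison

variable {G : Type*}

theorem adjoint_apply_mem_kerPerp (A : EllTwo G →L[ℂ] EllTwo G) (v : EllTwo G) :
    ContinuousLinearMap.adjoint A v ∈ kerPerp A := by
  rw [Submodule.mem_orthogonal]
  intro w hw
  rw [ContinuousLinearMap.adjoint_inner_right]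
  have : A w = 0 := hw
  rw [this, inner_zero_left]

/-- The range of `A^*` already lies in the complement of the kernel, so the projection in the
adjoint of `A_⊥` acts trivially. -/
theorem adjoint_restrictPerp_comp_apply (A : EllTwo G →L[ℂ] EllTwo G) (u : kerPerp A) :
    ((ContinuousLinearMap.adjoint (restrictPerp A) ∘L restrictPerp A) u : EllTwo G)
      = ContinuousLinearMap.adjoint A (A u) := by
  rw [restrictPerp, ContinuousLinearMap.adjoint_comp, Submodule.adjoint_subtypeL]
  exact congrArg Subtype.val (Submodule.orthogonalProjectionOnto_mem_subspace_eq_self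
    (⟨_, adjoint_apply_mem_kerPerp A (A u)⟩ : kerPerp A))

theorem norm_sq_mul_smul_le_re_inner (A : EllTwo G →L[ℂ] EllTwo G) {ε : ℝ} {u v : EllTwo G}
    (hu : ContinuousLinearMap.adjoint A (A u) + (ε : ℂ) • u = v) :
    ε * ‖u‖ ^ 2 ≤ (inner ℂ v u).re := by
  rw [← hu, inner_add_left, ContinuousLinearMap.adjoint_inner_left, inner_smul_left,
    inner_self_eq_norm_sq_to_K, inner_self_eq_norm_sq_to_K, Complex.add_re, Complex.conj_ofReal]
  have h1 : (((‖A u‖ : ℂ)) ^ 2).re = ‖A u‖ ^ 2 := by norm_cast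
  have h2 : ((ε : ℂ) * ((‖u‖ : ℂ)) ^ 2).re = ε * ‖u‖ ^ 2 := by norm_cast
  erw [h1, h2]
  nlinarith [sq_nonneg ‖A u‖]

/-- If `ε ⟨(A^* A + ε)⁻¹ v, v⟩ → 0` as `ε → 0`, then `v` is orthogonal to the kernel of `A`. -/
theorem mem_kerPerp_of_tendsto (A : EllTwo G →L[ℂ] EllTwo G) {v : EllTwo G} {u : ℝ → EllTwo G}
    (hu : ∀ ε > 0, ContinuousLinearMap.adjoint A (A (u ε)) + (ε : ℂ) • u ε = v)
    (hlim : Tendsto (fun ε => ε * (inner ℂ v (u ε)).re) (𝓝[>] 0) (𝓝 0)) : v ∈ kerPerp A := by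
  rw [Submodule.mem_orthogonal]
  intro w hw
  have hAw : A w = 0 := hw
  have hbound : ∀ ε > 0, ‖(inner ℂ w v : ℂ)‖ ^ 2 ≤ ‖w‖ ^ 2 * (ε * (inner ℂ v (u ε)).re) := by
    intro ε hε
    have h1 : (inner ℂ w v : ℂ) = ε * inner ℂ w (u ε) := by
      rw [← hu ε hε, inner_add_right, ContinuousLinearMap.adjoint_inner_right, hAw,
        inner_zero_left, zero_add, inner_smul_right]
    have h2 : ‖(inner ℂ w v : ℂ)‖ ≤ ε * (‖w‖ * ‖u ε‖) := by
      rw [h1, norm_mul, Complex.norm_real, Real.norm_of_nonneg hε.le]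
      exact mul_le_mul_of_nonneg_left (norm_inner_le_norm _ _) hε.le
    calc ‖(inner ℂ w v : ℂ)‖ ^ 2 ≤ (ε * (‖w‖ * ‖u ε‖)) ^ 2 := by gcongr
      _ = ‖w‖ ^ 2 * (ε * (ε * ‖u ε‖ ^ 2)) := by ring
      _ ≤ _ := by
        have := norm_sq_mul_smul_le_re_inner A (hu ε hε)
        gcongr
  have h0 : ‖(inner ℂ w v : ℂ)‖ ^ 2 ≤ ‖w‖ ^ 2 * 0 := by
    refine ge_of_tendsto (hlim.const_mul (‖w‖ ^ 2)) ?_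
    filter_upwards [self_mem_nhdsWithin] with ε hε using hbound ε hε
  rw [mul_zero] at h0
  exact norm_eq_zero.1 (pow_eq_zero_iff two_ne_zero |>.1 (le_antisymm h0 (sq_nonneg _)))

variable [Group G]

theorem vnTraceOn_eq_inner {K : Submodule ℂ (EllTwo G)} [K.HasOrthogonalProjection]
    (hK : deltaOne G ∈ K) (T : K →L[ℂ] K) :
    vnTraceOn K T = inner ℂ (⟨deltaOne G, hK⟩ : K) (T ⟨deltaOne G, hK⟩) := by
  have h : K.orthogonalProjectionOnto (deltaOne G) = ⟨deltaOne G, hK⟩ :=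
    Submodule.orthogonalProjectionOnto_mem_subspace_eq_self (⟨deltaOne G, hK⟩ : K)
  rw [vnTraceOn, vnTrace_eq_inner, Submodule.coe_inner]
  simp [h]

/-- The regularised Fuglede-Kadison determinant from the diagonal values of the resolvents. -/
theorem fkDetReg_of_resolvent (A : EllTwo G →L[ℂ] EllTwo G) {q : ℝ} (hq : 1 ≤ q)
    {u : ℝ → EllTwo G}
    (hu : ∀ ε > 0, ContinuousLinearMap.adjoint A (A (u ε)) + (ε : ℂ) • u ε = deltaOne G)
    (hu1 : ∀ ε > 0, u ε 1
      = ((smallRoot q ε / ((1 - smallRoot q ε) * (q + smallRoot q ε)) : ℝ) : ℂ))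
    {ε : ℝ} (hε : 0 < ε) :
    fkDetReg A ε = Real.exp (1 / 2 * (q * Real.log q - Real.log (smallRoot q ε)
      - (q - 1) * Real.log (q + smallRoot q ε))) := by
  have hq0 : 0 < q := by linarith
  have hmem : deltaOne G ∈ kerPerp A := by
    refine mem_kerPerp_of_tendsto A hu ?_
    -- By the equation for `smallRoot`, this is `ε` times the diagonal resolvent entry.
    have h1 : Tendsto (fun ε => q * (1 - smallRoot q ε) / (q + smallRoot q ε)) (𝓝[>] 0)
        (𝓝 (q * (1 - 1) / (q + 1))) :=
      Tendsto.div ((tendsto_const_nhds.sub (tendsto_smallRoot hq0)).const_mul q)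
        ((tendsto_smallRoot hq0).const_add q) (by positivity)
    simp only [sub_self, mul_zero, zero_div] at h1
    refine h1.congr' ?_
    filter_upwards [self_mem_nhdsWithin] with ε hε
    have hy := smallRoot_mem_Ioo hq0 hε
    have h2 : 1 - smallRoot q ε ≠ 0 := by linarith [hy.2]
    have h3 : q + smallRoot q ε ≠ 0 := by linarith [hy.1]
    have h4 := hy.1.ne'
    rw [inner_deltaOne, hu1 ε hε, Complex.ofReal_re]
    have h5 := smallRoot_spec hq0 hε
    rw [div_eq_iff h4] at h5
    rw [← mul_div_assoc, div_eq_div_iff h3 (mul_ne_zero h2 h3), ← h5]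
    ring
  set B := ContinuousLinearMap.adjoint (restrictPerp A) ∘L restrictPerp A with hB
  have hB0 : 0 ≤ B := by
    rw [ContinuousLinearMap.nonneg_iff_isPositive]
    exact ContinuousLinearMap.isPositive_adjoint_comp_self _
  set δ : kerPerp A := ⟨deltaOne G, hmem⟩ with hδ
  have hδ1 : ‖δ‖ = 1 := norm_deltaOne
  set f : ℝ → ℝ := fun ε =>
    (inner ℂ δ (opLog (B + (ε : ℂ) • ContinuousLinearMap.id ℂ (kerPerp A)) δ)).re with hf
  have hres : ∀ ε : ℝ, 0 < ε → ∃ w : kerPerp A, B w + (ε : ℂ) • w = δ ∧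
      (inner ℂ δ w).re = smallRoot q ε / ((1 - smallRoot q ε) * (q + smallRoot q ε)) := by
    intro ε hε
    have hεc : (ε : ℂ) ≠ 0 := by exact_mod_cast hε.ne'
    have hw : u ε ∈ kerPerp A := by
      have : u ε = (ε : ℂ)⁻¹ • (deltaOne G - ContinuousLinearMap.adjoint A (A (u ε))) := by
        rw [← hu ε hε, add_sub_cancel_left, inv_smul_smul₀ hεc]
      rw [this]
      exact Submodule.smul_mem _ _ (Submodule.sub_mem _ hmem (adjoint_apply_mem_kerPerp _ _))
    refine ⟨⟨u ε, hw⟩, Subtype.ext ?_, ?_⟩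
    · rw [Submodule.coe_add, adjoint_restrictPerp_comp_apply]
      exact hu ε hε
    · rw [Submodule.coe_inner, hδ, inner_deltaOne, hu1 ε hε, Complex.ofReal_re]
  have hfε : f ε = q * Real.log q - Real.log (smallRoot q ε)
      - (q - 1) * Real.log (q + smallRoot q ε) := by
    have := eq_of_supergradient (f := f) hq
      (fun ε hε => log_le_re_inner_opLog hB0 hε hδ1)
      (fun ε hε => re_inner_opLog_le hB0 hε hδ1) (fun y hy ε hε => ?_) (smallRoot_mem_Ioo hq0 hε)
    · rwa [smallRoot_spec hq0 hε] at this
    · have hy1 : 0 < 1 - y := by linarith [hy.2]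
      have hy0 := hy.1
      have hEy : 0 < q * (1 - y) ^ 2 / y := by positivity
      obtain ⟨w, hw, hw1⟩ := hres _ hEy
      have := re_inner_opLog_sub_le hB0 hEy hε hw
      rwa [hw1, smallRoot_eq hq0 hy] at this
  rw [fkDetReg, vnTraceOn_eq_inner hmem]
  rw [← hfε]

theorem tendsto_fkDetReg (A : EllTwo G →L[ℂ] EllTwo G) {q : ℝ} (hq : 1 ≤ q)
    {u : ℝ → EllTwo G}
    (hu : ∀ ε > 0, ContinuousLinearMap.adjoint A (A (u ε)) + (ε : ℂ) • u ε = deltaOne G)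
    (hu1 : ∀ ε > 0, u ε 1
      = ((smallRoot q ε / ((1 - smallRoot q ε) * (q + smallRoot q ε)) : ℝ) : ℂ)) :
    Tendsto (fkDetReg A) (𝓝[>] 0) (𝓝 (q ^ (q / 2) / (q + 1) ^ ((q - 1) / 2))) := by
  have hq0 : 0 < q := by linarith
  have hval : q ^ (q / 2) / (q + 1) ^ ((q - 1) / 2)
      = Real.exp (1 / 2 * (q * Real.log q - Real.log 1 - (q - 1) * Real.log (q + 1))) := by
    rw [Real.rpow_def_of_pos hq0, Real.rpow_def_of_pos (by linarith), ← Real.exp_sub,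
      Real.log_one]
    congr 1
    ring
  have hy := tendsto_smallRoot hq0
  rw [hval]
  refine Tendsto.congr' (f₁ := fun ε => Real.exp (1 / 2 * (q * Real.log q
    - Real.log (smallRoot q ε) - (q - 1) * Real.log (q + smallRoot q ε)))) ?_ ?_
  · filter_upwards [self_mem_nhdsWithin] with ε hε using (fkDetReg_of_resolvent A hq hu hu1 hε).symm
  · refine (Real.continuous_exp.tendsto _).comp (Tendsto.const_mul _ ?_)
    exact (tendsto_const_nhds.sub (hy.log one_ne_zero)).sub
      (((hy.const_add q).log (by linarith)).const_mul _)

/-- The Neumann series of `(1 - t T)⁻¹`, applied to `δ₁` and evaluated at `1`. -/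
theorem hasSum_vnTrace_pow (T : EllTwo G →L[ℂ] EllTwo G) {t : ℂ} (ht : ‖t • T‖ < 1)
    {u : EllTwo G} (hu : u - t • T u = deltaOne G) :
    HasSum (fun k : ℕ => vnTrace (T ^ k) * t ^ k) (u 1) := by
  have hS := (summable_geometric_of_norm_lt_one ht).hasSum
  have hmul := geom_series_mul_neg (t • T) ht
  have happ : (∑' k : ℕ, (t • T) ^ k) (deltaOne G) = u := by
    rw [← hu]
    exact congrArg (fun S : EllTwo G →L[ℂ] EllTwo G => S u) hmul
  have h := (hS.mapL (ContinuousLinearMap.apply ℂ (EllTwo G) (deltaOne G))).mapL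
    (innerSL ℂ (deltaOne G))
  have e1 : innerSL ℂ (deltaOne G) (ContinuousLinearMap.apply ℂ (EllTwo G) (deltaOne G)
      (∑' k : ℕ, (t • T) ^ k)) = u 1 := by
    rw [ContinuousLinearMap.apply_apply, happ, innerSL_apply_apply, inner_deltaOne]
  rw [e1] at h
  refine h.congr_fun fun k => ?_
  rw [vnTrace_eq_inner, smul_pow]
  simp [mul_comm]

end FugledeKadison

/-! ### Specialisation to weighted sums of letters -/

section LetterOp

variable {α G : Type*} [Fintype α] [DecidableEq α] [Nonempty α] [Group G]

theorem exists_regularized_resolvent_letterOp (e : FreeGroup α ≃* G) (c : α × Bool → Circle)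
    {q : ℝ} (hq : q = 2 * Fintype.card α - 1) {ε : ℝ} (hε : 0 < ε) :
    ∃ u : EllTwo G,
      ContinuousLinearMap.adjoint (letterOp e c) (letterOp e c u) + (ε : ℂ) • u = deltaOne G ∧
      u 1 = ((smallRoot q ε / ((1 - smallRoot q ε) * (q + smallRoot q ε)) : ℝ) : ℂ) := by
  have hcard : (1 : ℝ) ≤ Fintype.card α := by exact_mod_cast Fintype.card_pos (α := α)
  have hq0 : 0 < q := by linarith
  have hy := smallRoot_mem_Ioo hq0 hε
  have hspec := smallRoot_spec hq0 hε
  set y := smallRoot q ε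
  have hy0 := hy.1
  have hy1 : 0 < 1 - y := by linarith [hy.2]
  have hqy : 0 < q + y := by linarith
  obtain ⟨u, hu1, hu⟩ := exists_resolvent_letterOp e c (ρ := ((-(y / q) : ℝ) : ℂ)) (by
    rw [← hq, Complex.norm_real, norm_neg, Real.norm_of_nonneg (by positivity),
      mul_div_cancel₀ _ hq0.ne']
    exact hy.2)
  have hqc : (2 * (Fintype.card α : ℂ) - 1) = (q : ℂ) := by rw [hq]; push_cast; rfl
  have hεc : (ε : ℂ) ≠ 0 := by exact_mod_cast hε.ne'
  have ht : (((-(y / q) : ℝ) : ℂ) / (1 + (q : ℂ) * ((-(y / q) : ℝ) : ℂ)) ^ 2) = -(ε : ℂ)⁻¹ := by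
    have : -(y / q) / (1 + q * -(y / q)) ^ 2 = -ε⁻¹ := by
      rw [← hspec, mul_neg, mul_div_cancel₀ _ hq0.ne', ← sub_eq_add_neg]
      field_simp
    exact_mod_cast this
  rw [hqc] at hu hu1
  rw [ht] at hu
  refine ⟨(ε : ℂ)⁻¹ • u, ?_, ?_⟩
  · rw [smul_inv_smul₀ hεc, ← hu, map_smul, map_smul, neg_smul, sub_neg_eq_add, add_comm]
  · have h1 : ((ε : ℂ)⁻¹ • u) 1 = (ε : ℂ)⁻¹ * u 1 := rfl
    rw [h1, hu1]
    have : ε⁻¹ * ((1 + q * -(y / q)) / (1 - -(y / q))) = y / ((1 - y) * (q + y)) := by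
      rw [← hspec, mul_neg, mul_div_cancel₀ _ hq0.ne', ← sub_eq_add_neg, sub_neg_eq_add]
      have : 1 + y / q = (q + y) / q := by field_simp
      rw [this]
      field_simp
    have := congrArg (fun r : ℝ => (r : ℂ)) this
    push_cast at this ⊢
    exact this

theorem tendsto_fkDetReg_letterOp (e : FreeGroup α ≃* G) (c : α × Bool → Circle) {q : ℝ}
    (hq : q = 2 * Fintype.card α - 1) :
    Tendsto (fkDetReg (letterOp e c)) (𝓝[>] 0) (𝓝 (q ^ (q / 2) / (q + 1) ^ ((q - 1) / 2))) := by
  have hcard : (1 : ℝ) ≤ Fintype.card α := by exact_mod_cast Fintype.card_pos (α := α)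
  have h : ∀ ε : ℝ, ∃ u : EllTwo G, 0 < ε →
      ContinuousLinearMap.adjoint (letterOp e c) (letterOp e c u) + (ε : ℂ) • u = deltaOne G ∧
      u 1 = ((smallRoot q ε / ((1 - smallRoot q ε) * (q + smallRoot q ε)) : ℝ) : ℂ) := by
    intro ε
    by_cases hε : 0 < ε
    · obtain ⟨u, hu⟩ := exists_regularized_resolvent_letterOp e c hq hε
      exact ⟨u, fun _ => hu⟩
    · exact ⟨0, fun h => absurd h hε⟩
  choose u hu using h
  exact tendsto_fkDetReg _ (by linarith) (fun ε hε => (hu ε hε).1) fun ε hε => (hu ε hε).2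

theorem eventually_hasSum_vnTrace_letterOp (e : FreeGroup α ≃* G) (c : α × Bool → Circle) {q : ℂ}
    (hq : q = 2 * Fintype.card α - 1) :
    ∀ᶠ t : ℂ in 𝓝 0, HasSum
      (fun k : ℕ => vnTrace
        ((ContinuousLinearMap.adjoint (letterOp e c) * letterOp e c) ^ k) * t ^ k)
      (2 * q / (q - 1 + (q + 1) * Complex.sqrt (1 - 4 * q * t))) := by
  have hcard : 0 < Fintype.card α := Fintype.card_pos
  have hq0 : q ≠ 0 := by
    rw [hq, sub_ne_zero]
    norm_cast
    omega
  set T := ContinuousLinearMap.adjoint (letterOp e c) * letterOp e c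
  have hS : ContinuousAt (fun t : ℂ => Complex.sqrt (1 - 4 * q * t)) 0 :=
    ContinuousAt.comp (f := fun t : ℂ => 1 - 4 * q * t) (g := Complex.sqrt)
      (Complex.continuousAt_sqrt (by simp)) (by fun_prop)
  have h1S : ∀ᶠ t : ℂ in 𝓝 0, 1 + Complex.sqrt (1 - 4 * q * t) ≠ 0 :=
    (continuousAt_const.add hS).eventually_ne (by simp)
  -- The root `ρ` of `t (1 + qρ)² = ρ` that vanishes at `t = 0`; continuity keeps `q‖ρ‖ < 1` nearby.
  have hρ : ∀ᶠ t : ℂ in 𝓝 0, (2 * Fintype.card α - 1 : ℝ) *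
      ‖(1 - Complex.sqrt (1 - 4 * q * t)) / (1 + Complex.sqrt (1 - 4 * q * t)) / q‖ < 1 := by
    have hc : ContinuousAt (fun t : ℂ => (2 * Fintype.card α - 1 : ℝ) *
        ‖(1 - Complex.sqrt (1 - 4 * q * t)) / (1 + Complex.sqrt (1 - 4 * q * t)) / q‖) 0 :=
      continuousAt_const.mul (((continuousAt_const.sub hS).div (continuousAt_const.add hS)
        (by simp)).div_const q).norm
    exact hc.eventually_lt continuousAt_const (by simp)
  have hT : ∀ᶠ t : ℂ in 𝓝 0, ‖t • T‖ < 1 :=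
    (ContinuousAt.norm (by fun_prop : ContinuousAt (fun t : ℂ => t • T) 0)).eventually_lt
      continuousAt_const (by simp)
  filter_upwards [h1S, hρ, hT] with t h1 h2 h3
  have hsq : Complex.sqrt (1 - 4 * q * t) ^ 2 = 1 - 4 * q * t := by
    rw [Complex.sqrt, ← Complex.cpow_nat_mul]
    simp
  set S := Complex.sqrt (1 - 4 * q * t)
  obtain ⟨u, hu1, hu⟩ := exists_resolvent_letterOp e c h2
  have h4 : 1 + q * ((1 - S) / (1 + S) / q) = 2 / (1 + S) := by
    field_simp
    ring
  rw [← hq, h4] at hu hu1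
  have h5 : (1 - S) / (1 + S) / q / (2 / (1 + S)) ^ 2 = t := by
    field_simp
    linear_combination -hsq
  have h6 : 2 / (1 + S) / (1 - (1 - S) / (1 + S) / q) = 2 * q / (q - 1 + (q + 1) * S) := by
    have : 1 - (1 - S) / (1 + S) / q = (q - 1 + (q + 1) * S) / ((1 + S) * q) := by
      field_simp
      ring
    rw [this, div_div_div_eq, ← mul_div_mul_left (2 * q) _ h1]
    ring_nf
  rw [h5] at hu
  rw [h6] at hu1
  rw [← hu1]
  exact hasSum_vnTrace_pow T h3 hu

end LetterOp

theorem exists_symmetricOp_eq_letterOp {d : ℕ} {x : Fin d → FreeGroup (Fin d)}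
    (hx : Subgroup.closure (Set.range x) = ⊤) {ζ ξ : Fin d → ℂ} (hζ : ∀ i, ‖ζ i‖ = 1)
    (hξ : ∀ i, ‖ξ i‖ = 1) :
    ∃ (e : FreeGroup (Fin d) ≃* FreeGroup (Fin d)) (c : Fin d × Bool → Circle),
      symmetricOp x ζ ξ = letterOp e c := by
  obtain ⟨e, he⟩ := FreeGroup.exists_mulEquiv_of_closure_eq_top hx
  refine ⟨e, fun s => if s.2 then ⟨ζ s.1, mem_sphere_zero_iff_norm.2 (hζ _)⟩
    else ⟨ξ s.1, mem_sphere_zero_iff_norm.2 (hξ _)⟩, ?_⟩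
  rw [symmetricOp, letterOp, Fintype.sum_prod_type]
  refine Finset.sum_congr rfl fun i _ => ?_
  rw [Fintype.sum_bool]
  simp [FreeGroup.mk_singleton_eq, he]

theorem corollary2p4 (d : ℕ) (hd : 2 ≤ d)
    (x : Fin d → FreeGroup (Fin d)) (hx : Subgroup.closure (Set.range x) = ⊤)
    (ζ ξ : Fin d → ℂ) (hζ : ∀ i, ‖ζ i‖ = 1) (hξ : ∀ i, ‖ξ i‖ = 1) :
    (∀ᶠ t : ℂ in 𝓝 0,
      HasSum
        (fun k : ℕ => vnTrace
          ((ContinuousLinearMap.adjoint (symmetricOp x ζ ξ) * symmetricOp x ζ ξ) ^ k) * t ^ k)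
        ((4 * (d : ℂ) - 2) /
          (2 * (d : ℂ) - 2 + 2 * (d : ℂ) * Complex.sqrt (1 - 4 * (2 * (d : ℂ) - 1) * t)))) ∧
    Tendsto (fkDetReg (symmetricOp x ζ ξ)) (𝓝[>] 0)
      (𝓝 ((2 * (d : ℝ) - 1) ^ ((2 * (d : ℝ) - 1) / 2) / (2 * (d : ℝ)) ^ ((d : ℝ) - 1))) ∧
    fkDet (symmetricOp x ζ ξ)
      = (2 * (d : ℝ) - 1) ^ ((2 * (d : ℝ) - 1) / 2) / (2 * (d : ℝ)) ^ ((d : ℝ) - 1) := by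
  have : Nonempty (Fin d) := ⟨⟨0, by omega⟩⟩
  obtain ⟨e, c, hA⟩ := exists_symmetricOp_eq_letterOp hx hζ hξ
  have hlim : Tendsto (fkDetReg (symmetricOp x ζ ξ)) (𝓝[>] 0)
      (𝓝 ((2 * (d : ℝ) - 1) ^ ((2 * (d : ℝ) - 1) / 2) / (2 * (d : ℝ)) ^ ((d : ℝ) - 1))) := by
    have h := tendsto_fkDetReg_letterOp e c (q := 2 * (d : ℝ) - 1) (by simp)
    rw [hA]
    rwa [sub_add_cancel, show (2 * (d : ℝ) - 1 - 1) / 2 = d - 1 by ring] at h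
  refine ⟨?_, hlim, hlim.limUnder_eq⟩
  rw [hA]
  filter_upwards [eventually_hasSum_vnTrace_letterOp e c (q := 2 * (d : ℂ) - 1) (by simp)]
    with t ht
  rwa [sub_add_cancel, show 2 * (2 * (d : ℂ) - 1) = 4 * d - 2 by ring,
    show 2 * (d : ℂ) - 1 - 1 = 2 * d - 2 by ring] at ht
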